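/- Let $\mathrm{PG}(n,q)$ denote the $n$-dimensional projective space over the finite field $\mathbb{F}_q$, where $q$ is a prime power with $q \geq 3$. A cap in $\mathrm{PG}(n,q)$ is a set $\mathcal{C}$ of points no three of which are collinear. A point not in $\mathcal{C}$ is called exterior, and a secant of $\mathcal{C}$ is a line that meets $\mathcal{C}$ in precisely two points. For an exterior point $p$, let $h_p$ denote the number of secants through $p$, and let $h$ denote the average of $h_p$ over all exterior points $p$. Let $c$ be a real constant. Consider caps $\mathcal{C}$, of size $t = |\mathcal{C}|$, in $\mathrm{PG}(n,q)$ with $n \geq 4$ and $q \geq 3$ such that $|h - h_p| \leq c$ for all exterior points $p$. Then $t = O(q^{\frac56 n - \frac16})$, both for $n$ fixed and $q \to \infty$, and for $q$ fixed and $n \to \infty$. That is: 1. For every $n \geq 4$ and every $c$ there is a constant $K = K(n,c)$ such that, for all prime powers $q \geq 3$, every such cap in $\mathrm{PG}(n,q)$ satisfies $t \leq K q^{\frac56 n - \frac16}$. 2. For every prime power $q \geq 3$ and every $c$ there is a constant $K = K(q,c)$ such that, for all $n \geq 4$, every such cap in $\mathrm{PG}(n,q)$ satisfies $t \leq K q^{\frac56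 n - \frac16}$. -/

import Mathlib

open scoped LinearAlgebra.Projectivization

/-- The `n`-dimensional projective space `PG(n, F)` over the field `F`. -/
abbrev PG (n : ℕ) (F : Type*) [Field F] : Type _ := ℙ F (Fin (n + 1) → F)

section Caps

variable {n : ℕ} {F : Type*} [Field F]

/-- A cap is a set of points such that no three (distinct) points of it are collinear. -/
def IsCap (C : Set (PG n F)) : Prop :=
  ∀ x ∈ C, ∀ y ∈ C, ∀ z ∈ C, x ≠ y → x ≠ z → y ≠ z →
    ¬ Projectivization.IsCollinear ({x, y, z} : Set (PG n F))

/-- A line of `PG(n, F)`: a projective subspace whose vector space dimension is two. -/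
def IsLine (L : Projectivization.Subspace F (Fin (n + 1) → F)) : Prop :=
  Module.finrank F L.submodule = 2

/-- A secant of `C` is a line which meets `C` in precisely two points. -/
def IsSecant (C : Set (PG n F)) (L : Projectivization.Subspace F (Fin (n + 1) → F)) : Prop :=
  IsLine L ∧ (C ∩ (L : Set (PG n F))).ncard = 2

/-- The number `h_p` of secants of `C` through the point `p`. -/
noncomputable def numSecants (C : Set (PG n F)) (p : PG n F) : ℕ :=
  {L : Projectivization.Subspace F (Fin (n + 1) → F) | IsSecant C L ∧ p ∈ L}.ncard

/-- The expected number `h` of secants of `C` through an exterior point, that is, the average of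
`h_p` over all points `p` outside `C`. -/
noncomputable def meanSecants (C : Set (PG n F)) : ℝ :=
  (∑ᶠ p ∈ Cᶜ, (numSecants C p : ℝ)) / (Cᶜ.ncard : ℝ)

/-- For every point `p` outside `C`, the number of secants through `p` differs from the mean
by at most `c`. -/
def SecantDeviationLE (C : Set (PG n F)) (c : ℝ) : Prop :=
  ∀ p ∉ C, |meanSecants C - (numSecants C p : ℝ)| ≤ c

end Caps

/-! Let `D` be the cone of nonzero vectors over the cap: a symmetric set of size k = t(q - 1) in a
group of order Q = q^(n+1). Count the ways of writing x as a sum of two elements of `D`. By the cap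
property there are q - 2 ways when x lies in `D`; for nonzero x outside `D` there are twice as many
as secants through the point of x, hence nearly a constant a. On the Fourier side the character sums
L of `D` then satisfy L² + bL ≈ k - a with b = a - (q - 2), in mean square over the nontrivial
characters (`sum_quadratic_charSum_le`). If k is large, double counting gives b ≥ k²/(4Q), so one
root is a small positive s of order k/b and the other is -b - s; by Parseval L can be near the
latter only on a set T of O(Qk/b²) characters.

This is impossible when T is sparse (`mass_outside_lower_bound`, `no_sparse_almost_two_valued`). The
indicator of `D` is idempotent, so L * L = QL, and u = L - s has u * u = Q(L + s²), which is about
Q(s + s²) > 0 at most characters. Yet u is nearly supported on T, so u * u nearly lives on T + T,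
which misses half of the dual group once 2|T|² ≤ Q. Inserting |T| ~ Qk/b² and b ~ k²/Q, this
excludes all k beyond a constant times Q^(5/6), whence t = O(q^(5n/6 - 1/6)). -/

/-! ### Convolution idempotents that are almost two-valued. -/

/-- A nonnegative-root estimate: if `s ≥ 0` solves `s² + b s = m`, then away from `λ ≤ -b/2` the
quantity `λ² + b λ - m` controls `λ - s`. -/
lemma sq_sub_root_le {s b m x : ℝ} (hb : 0 < b) (hs : 0 ≤ s) (hroot : s ^ 2 + b * s = m)
    (hx : -b / 2 < x) : (x - s) ^ 2 ≤ 4 / b ^ 2 * (x ^ 2 + b * x - m) ^ 2 := by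
  have h1 : x ^ 2 + b * x - m = (x - s) * (x + b + s) := by rw [← hroot]; ring
  have h2 : b / 2 ≤ x + b + s := by linarith
  have h3 : (b / 2) ^ 2 ≤ (x + b + s) ^ 2 := by gcongr
  rw [h1, mul_pow]
  have h4 : 4 / b ^ 2 * ((x - s) ^ 2 * (x + b + s) ^ 2)
      = (x - s) ^ 2 * (4 / b ^ 2 * (x + b + s) ^ 2) := by ring
  rw [h4]
  have h5 : 1 ≤ 4 / b ^ 2 * (x + b + s) ^ 2 := by
    calc (1 : ℝ) = 4 / b ^ 2 * (b / 2) ^ 2 := by field_simp; norm_num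
      _ ≤ _ := by gcongr
  nlinarith [sq_nonneg (x - s)]

/-- Sum of a convolution over the whole group. -/
lemma sum_sum_mul_sub {Γ : Type*} [Fintype Γ] [AddCommGroup Γ] (f g : Γ → ℝ) :
    ∑ ψ, ∑ φ, f φ * g (ψ - φ) = (∑ φ, f φ) * ∑ φ, g φ := by
  rw [Finset.sum_comm, Finset.sum_mul]
  refine Finset.sum_congr rfl fun φ _ ↦ ?_
  rw [← Finset.mul_sum]
  congr 1
  exact Fintype.sum_equiv (Equiv.subRight φ) _ _ fun _ ↦ rfl

open Finset Pointwise in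
/-- Let `u = L - s` satisfy `u * u = Q (L + s²)` with respect to convolution. If `T` is a set with
`2 |T|² ≤ Q` then the mass of `u` outside `T` cannot be too small. -/
lemma mass_outside_lower_bound {Γ : Type*} [Fintype Γ] [DecidableEq Γ] [AddCommGroup Γ]
    (L : Γ → ℝ) (s : ℝ) (hs : 0 ≤ s) (T : Finset Γ) (h0 : (0 : Γ) ∈ T)
    (hT : 2 * (#T : ℝ) ^ 2 ≤ (Fintype.card Γ : ℝ))
    (hconv : ∀ ψ, ∑ φ, L φ * L (ψ - φ) = Fintype.card Γ * L ψ) (hsum : ∑ ψ, L ψ = 0) :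
    (Fintype.card Γ : ℝ) ^ 2 / 2 * (s + s ^ 2) ≤ (∑ ψ ∈ Tᶜ, |L ψ - s|) *
      (Fintype.card Γ + 2 * (∑ ψ ∈ T, |L ψ - s|) + ∑ ψ ∈ Tᶜ, |L ψ - s|) := by
  set Q : ℝ := (Fintype.card Γ : ℝ) with hQ
  -- Split |L - s| into its part `w` on `T` and its part `e` off `T`.
  set w : Γ → ℝ := fun ψ ↦ if ψ ∈ T then |L ψ - s| else 0 with hw
  set e : Γ → ℝ := fun ψ ↦ if ψ ∈ T then 0 else |L ψ - s| with he
  have hwsum : ∑ ψ, w ψ = ∑ ψ ∈ T, |L ψ - s| := by simp [hw, Finset.sum_ite_mem]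
  have hesum : ∑ ψ, e ψ = ∑ ψ ∈ Tᶜ, |L ψ - s| := by
    rw [← Finset.sum_add_sum_compl T]
    rw [Finset.sum_eq_zero (s := T) (fun x hx ↦ by simp [he, hx]), zero_add]
    exact Finset.sum_congr rfl fun x hx ↦ by simp [he, Finset.mem_compl.1 hx]
  have hw0 : ∀ ψ, 0 ≤ w ψ := fun ψ ↦ by simp only [hw]; split_ifs <;> positivity
  have he0 : ∀ ψ, 0 ≤ e ψ := fun ψ ↦ by simp only [he]; split_ifs <;> positivity
  have habs : ∀ ψ, |L ψ - s| = w ψ + e ψ := fun ψ ↦ by simp only [hw, he]; split_ifs <;> simp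
  rw [← hwsum, ← hesum]
  have huu : ∀ ψ, ∑ φ, (L φ - s) * (L (ψ - φ) - s) = Q * (L ψ + s ^ 2) := by
    intro ψ
    have h1 : ∑ φ, L (ψ - φ) = 0 := by
      rw [← hsum]; exact Fintype.sum_equiv (Equiv.subLeft ψ) _ _ fun _ ↦ rfl
    calc ∑ φ, (L φ - s) * (L (ψ - φ) - s)
        = ∑ φ, (L φ * L (ψ - φ) - s * L φ - s * L (ψ - φ) + s ^ 2) :=
          Finset.sum_congr rfl fun φ _ ↦ by ring
      _ = Q * (L ψ + s ^ 2) := by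
          rw [Finset.sum_add_distrib, Finset.sum_sub_distrib, Finset.sum_sub_distrib,
            ← Finset.mul_sum, ← Finset.mul_sum, h1, hsum, hconv]
          simp [hQ]; ring
  -- Off `T + T` the convolution `w * w` vanishes, so only terms involving the small part `e`
  -- remain.
  set P : Finset Γ := (T + T)ᶜ with hP
  have hPcard : Q / 2 ≤ (#P : ℝ) := by
    have h1 : #(T + T) + #P = Fintype.card Γ := Finset.card_add_card_compl _
    have h2 : #(T + T) ≤ #T * #T := Finset.card_add_le
    have h3 : (#(T + T) : ℝ) + #P = Q := by rw [hQ, ← h1]; push_cast; ring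
    have h4 : (#(T + T) : ℝ) ≤ (#T : ℝ) * #T := by exact_mod_cast h2
    nlinarith
  have hpoint : ∀ ψ ∈ P, Q * (s + s ^ 2) ≤ Q * e ψ +
      (∑ φ, w φ * e (ψ - φ) + ∑ φ, e φ * w (ψ - φ) + ∑ φ, e φ * e (ψ - φ)) := by
    intro ψ hψ
    have hψ' : ψ ∉ T + T := Finset.mem_compl.1 hψ
    -- Since 0 lies in `T`, `T` is contained in `T + T`; this gives L ψ ≥ s - `e` ψ on `P`.
    have hψT : ψ ∉ T := fun h ↦ hψ' (by simpa using Finset.add_mem_add h h0)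
    have hle : -(L ψ - s) ≤ e ψ := by simp only [he, hψT, if_false]; exact neg_le_abs _
    have hww : ∀ φ, w φ * w (ψ - φ) = 0 := by
      intro φ
      by_cases h1 : φ ∈ T
      · by_cases h2 : ψ - φ ∈ T
        · exact absurd (by simpa using Finset.add_mem_add h1 h2) hψ'
        · simp [hw, h2]
      · simp [hw, h1]
    have hub : ∑ φ, (L φ - s) * (L (ψ - φ) - s) ≤
        ∑ φ, w φ * e (ψ - φ) + ∑ φ, e φ * w (ψ - φ) + ∑ φ, e φ * e (ψ - φ) := by
      rw [← Finset.sum_add_distrib, ← Finset.sum_add_distrib]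
      refine Finset.sum_le_sum fun φ _ ↦ (le_abs_self _).trans ?_
      rw [abs_mul, habs, habs]
      linarith [hww φ]
    rw [huu] at hub
    have hQ0 : 0 ≤ Q := by positivity
    nlinarith
  have hQs : 0 ≤ Q * (s + s ^ 2) := by positivity
  calc Q ^ 2 / 2 * (s + s ^ 2) = Q / 2 * (Q * (s + s ^ 2)) := by ring
    _ ≤ #P * (Q * (s + s ^ 2)) := by gcongr
    _ = ∑ ψ ∈ P, Q * (s + s ^ 2) := by simp
    _ ≤ ∑ ψ ∈ P, (Q * e ψ +
      (∑ φ, w φ * e (ψ - φ) + ∑ φ, e φ * w (ψ - φ) + ∑ φ, e φ * e (ψ - φ))) :=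
        Finset.sum_le_sum hpoint
    _ ≤ ∑ ψ, (Q * e ψ +
      (∑ φ, w φ * e (ψ - φ) + ∑ φ, e φ * w (ψ - φ) + ∑ φ, e φ * e (ψ - φ))) := by
        refine Finset.sum_le_univ_sum_of_nonneg fun ψ ↦ ?_
        have h1 : 0 ≤ ∑ φ, w φ * e (ψ - φ) :=
          Finset.sum_nonneg fun φ _ ↦ mul_nonneg (hw0 _) (he0 _)
        have h2 : 0 ≤ ∑ φ, e φ * w (ψ - φ) :=
          Finset.sum_nonneg fun φ _ ↦ mul_nonneg (he0 _) (hw0 _)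
        have h3 : 0 ≤ ∑ φ, e φ * e (ψ - φ) :=
          Finset.sum_nonneg fun φ _ ↦ mul_nonneg (he0 _) (he0 _)
        have := mul_nonneg (show 0 ≤ Q by positivity) (he0 ψ)
        linarith
    _ = _ := by
        simp only [Finset.sum_add_distrib, sum_sum_mul_sub, ← Finset.mul_sum]
        ring

/-- The numerical incompatibility behind `no_sparse_almost_two_valued`. -/
lemma mass_bound_contradiction {Q σ s E W : ℝ} (hQ : 0 < Q) (hσ : 0 < σ) (hs : σ / 5 ≤ s)
    (hE0 : 0 ≤ E) (hW0 : 0 ≤ W) (hE : E ≤ Q * σ / 500) (hW : W ≤ 4 * (Q * σ)) :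
    E * (Q + 2 * W + E) < Q ^ 2 / 2 * (s + s ^ 2) := by
  calc E * (Q + 2 * W + E) ≤ Q * σ / 500 * (Q + 2 * (4 * (Q * σ)) + Q * σ / 500) := by gcongr
    _ = Q ^ 2 * (σ / 500 + 4001 / 250000 * σ ^ 2) := by ring
    _ < Q ^ 2 * (σ / 10 + σ ^ 2 / 50) := by
      have : 0 < σ ^ 2 := by positivity
      gcongr ?_ * ?_
      linarith
    _ = Q ^ 2 / 2 * (σ / 5 + (σ / 5) ^ 2) := by ring
    _ ≤ _ := by gcongr

open Finset in
set_option maxHeartbeats 1000000 in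
/-- A function on a finite abelian group which is (up to the factor `Q`) idempotent for convolution
and which nearly satisfies a quadratic equation pointwise cannot exist
when one of the two roots is attained too rarely. -/
lemma no_sparse_almost_two_valued {Γ : Type*} [Fintype Γ] [DecidableEq Γ] [AddCommGroup Γ]
    (L : Γ → ℝ) (Q k a b η : ℝ) (hQ : Q = Fintype.card Γ)
    (hk : 0 < k) (hb : 0 < b) (hkb : k ≤ b ^ 2) (hbk : b ≤ k) (hkQ : k ≤ Q)
    (ha : a ≤ k / 2 + η) (hη : 1000000 * η ^ 2 * Q ≤ k ^ 2) (hbig : 50 * Q * k ^ 2 ≤ b ^ 4)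
    (ha0 : 0 ≤ a) (hsq : ∑ ψ, L ψ ^ 2 = Q * k)
    (hquad : ∑ ψ ∈ univ.erase (0 : Γ), (L ψ ^ 2 + b * L ψ - (k - a)) ^ 2 ≤ Q ^ 2 * η ^ 2)
    (hconv : ∀ ψ, ∑ φ, L φ * L (ψ - φ) = Q * L ψ) (hsum : ∑ ψ, L ψ = 0) : False := by
  have hQ1 : 1 ≤ Q := by rw [hQ]; exact_mod_cast Fintype.card_pos
  have hη1 : η ≤ k / 1000 := by
    refine (abs_le_of_sq_le_sq' (a := η) ?_ (by positivity)).2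
    nlinarith [sq_nonneg η]
  have hm : 2 / 5 * k ≤ k - a := by linarith
  set m := k - a with hmdef
  have hmk : m ≤ k := by linarith
  obtain ⟨s, hs0, hroot⟩ : ∃ s : ℝ, 0 ≤ s ∧ s ^ 2 + b * s = m := by
    have hm0 : 0 ≤ m := by linarith
    have hd : 0 ≤ b ^ 2 + 4 * m := by positivity
    refine ⟨(√(b ^ 2 + 4 * m) - b) / 2, ?_, ?_⟩
    · have : b ≤ √(b ^ 2 + 4 * m) := Real.le_sqrt_of_sq_le (by linarith)
      linarith
    · have := Real.sq_sqrt hd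
      linarith
  obtain ⟨σ, hσ⟩ : ∃ σ, σ = k / b := ⟨_, rfl⟩
  have hkσ : k = σ * b := by rw [hσ]; field_simp
  have hσ0 : 0 < σ := by rw [hσ]; positivity
  clear hσ
  -- The root `s` is comparable to `σ` = k/b: s·b ≤ k gives the upper bound, and s ≤ σ ≤ b turns s(s
  -- + b) ≥ 2k/5 into the lower one.
  have hσb : σ ≤ b := le_of_mul_le_mul_right (by rw [← hkσ]; linarith) hb
  have hsσ : s ≤ σ := le_of_mul_le_mul_right (by rw [← hkσ]; nlinarith) hb
  have hσs : σ / 5 ≤ s := le_of_mul_le_mul_right (a := b) (by nlinarith) hb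
  -- The characters closer to the negative root. The trivial one is added because the quadratic
  -- relation says nothing there.
  obtain ⟨T, hT⟩ : ∃ T : Finset Γ, T = insert 0 (univ.filter fun ψ ↦ L ψ ≤ -b / 2) := ⟨_, rfl⟩
  -- Chebyshev gives 4Qk/b² characters with L ≤ -b/2; the inserted 0 costs one more Qk/b².
  have hTcard : (#T : ℝ) * b ^ 2 ≤ 5 * Q * k := by
    have h1 : (#T : ℝ) ≤ #(univ.filter fun ψ ↦ L ψ ≤ -b / 2) + 1 := by
      rw [hT]
      exact_mod_cast Finset.card_insert_le _ _
    have h2 : (#(univ.filter fun ψ ↦ L ψ ≤ -b / 2) : ℝ) * (b ^ 2 / 4) ≤ Q * k := by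
      rw [← hsq, ← nsmul_eq_mul]
      refine (Finset.card_nsmul_le_sum _ _ _ fun ψ hψ ↦ ?_).trans
        (Finset.sum_le_univ_sum_of_nonneg (f := fun ψ ↦ L ψ ^ 2) fun _ ↦ sq_nonneg _)
      have := (Finset.mem_filter.1 hψ).2
      nlinarith
    have h3 : b ^ 2 ≤ Q * k := by nlinarith
    nlinarith [sq_nonneg b]
  have hTQ : (#T : ℝ) ≤ Q := by rw [hQ]; exact_mod_cast Finset.card_le_univ T
  have hT2 : 2 * (#T : ℝ) ^ 2 ≤ Q := by
    refine le_of_mul_le_mul_right (a := b ^ 4) ?_ (by positivity)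
    calc 2 * (#T : ℝ) ^ 2 * b ^ 4 = 2 * ((#T : ℝ) * b ^ 2) ^ 2 := by ring
      _ ≤ 2 * (5 * Q * k) ^ 2 := by gcongr
      _ = Q * (50 * Q * k ^ 2) := by ring
      _ ≤ Q * b ^ 4 := by gcongr
  have key := mass_outside_lower_bound L s hs0 T (by simp [hT]) (by rw [← hQ]; exact hT2)
    (by rw [← hQ]; exact hconv) hsum
  rw [← hQ] at key
  have hW : ∑ ψ ∈ T, |L ψ - s| ≤ 4 * (Q * σ) := by
    have h1 : (∑ ψ ∈ T, |L ψ|) ^ 2 ≤ (3 * (Q * σ)) ^ 2 := by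
      have h2 : (∑ ψ ∈ T, |L ψ|) ^ 2 ≤ #T * (Q * k) := by
        refine sq_sum_le_card_mul_sum_sq.trans ?_
        gcongr
        rw [← hsq]
        simp only [sq_abs]
        exact Finset.sum_le_univ_sum_of_nonneg fun _ ↦ sq_nonneg _
      refine le_of_mul_le_mul_right (a := b ^ 2) ?_ (by positivity)
      calc _ ≤ #T * (Q * k) * b ^ 2 := by gcongr
        _ = (#T * b ^ 2) * (Q * k) := by ring
        _ ≤ (5 * Q * k) * (Q * k) := by gcongr
        _ ≤ 9 * (Q * k) ^ 2 := by nlinarith [sq_nonneg (Q * k)]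
        _ = _ := by rw [hkσ]; ring
    have h2 : ∑ ψ ∈ T, |L ψ| ≤ 3 * (Q * σ) := (abs_le_of_sq_le_sq' h1 (by positivity)).2
    calc ∑ ψ ∈ T, |L ψ - s| ≤ ∑ ψ ∈ T, (|L ψ| + s) := Finset.sum_le_sum fun ψ _ ↦ by
          simpa [abs_of_nonneg hs0] using abs_sub (L ψ) s
      _ = ∑ ψ ∈ T, |L ψ| + #T * s := by rw [Finset.sum_add_distrib]; simp
      _ ≤ 3 * (Q * σ) + Q * σ := by gcongr
      _ = _ := by ring
  -- Cauchy–Schwarz: the sum is at most √Q · (2/b) · Qη, and 1000 η √Q ≤ k.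
  have hE : ∑ ψ ∈ Tᶜ, |L ψ - s| ≤ Q * σ / 500 := by
    refine (abs_le_of_sq_le_sq' ?_ (by positivity)).2
    have h1 : ∑ ψ ∈ Tᶜ, |L ψ - s| ^ 2 ≤ 4 / b ^ 2 * (Q ^ 2 * η ^ 2) := by
      calc ∑ ψ ∈ Tᶜ, |L ψ - s| ^ 2
          ≤ ∑ ψ ∈ Tᶜ, 4 / b ^ 2 * (L ψ ^ 2 + b * L ψ - m) ^ 2 := by
            refine Finset.sum_le_sum fun ψ hψ ↦ ?_
            rw [sq_abs]
            refine sq_sub_root_le hb hs0 hroot ?_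
            simp only [hT, Finset.mem_compl, Finset.mem_insert, Finset.mem_filter] at hψ
            by_contra hcon
            exact hψ (Or.inr ⟨Finset.mem_univ _, not_lt.1 hcon⟩)
        _ = 4 / b ^ 2 * ∑ ψ ∈ Tᶜ, (L ψ ^ 2 + b * L ψ - m) ^ 2 := by rw [Finset.mul_sum]
        _ ≤ _ := by
            gcongr
            refine le_trans ?_ hquad
            refine Finset.sum_le_sum_of_subset_of_nonneg (fun ψ hψ ↦ ?_) fun _ _ _ ↦ sq_nonneg _
            simp only [Finset.mem_erase, Finset.mem_univ, and_true]
            rintro rfl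
            simp [hT] at hψ
    have h2 : (#Tᶜ : ℝ) ≤ Q := by rw [hQ]; exact_mod_cast Finset.card_le_univ _
    calc (∑ ψ ∈ Tᶜ, |L ψ - s|) ^ 2 ≤ #Tᶜ * ∑ ψ ∈ Tᶜ, |L ψ - s| ^ 2 := sq_sum_le_card_mul_sum_sq
      _ ≤ Q * (4 / b ^ 2 * (Q ^ 2 * η ^ 2)) := by gcongr
      _ = 4 * Q ^ 2 / (1000000 * b ^ 2) * (1000000 * η ^ 2 * Q) := by field_simp
      _ ≤ 4 * Q ^ 2 / (1000000 * b ^ 2) * k ^ 2 := by gcongr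
      _ = (Q * σ / 500) ^ 2 := by rw [hkσ]; field_simp; norm_num
  have hE0 : 0 ≤ ∑ ψ ∈ Tᶜ, |L ψ - s| := Finset.sum_nonneg fun _ _ ↦ abs_nonneg _
  have hW0 : 0 ≤ ∑ ψ ∈ T, |L ψ - s| := Finset.sum_nonneg fun _ _ ↦ abs_nonneg _
  exact absurd key (not_le.2 (mass_bound_contradiction (by linarith) hσ0 hσs hE0 hW0 hE hW))

/-! ### Character sums of a symmetric set and its sum representations. -/

section CharacterSums

open Finset ComplexConjugate

variable {G : Type*} [AddCommGroup G]

/-- The real part of the sum of an additive character over a finite set. -/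
noncomputable def charSum (D : Finset G) (ψ : AddChar G ℂ) : ℝ := ∑ x ∈ D, (ψ x).re

/-- The number of representations of `z` as a sum of two elements of `D`. -/
def numSumReps [DecidableEq G] (D : Finset G) (z : G) : ℕ := #{d ∈ D | z - d ∈ D}

lemma ofReal_charSum [Finite G] {D : Finset G} (hneg : ∀ x ∈ D, -x ∈ D) (ψ : AddChar G ℂ) :
    (charSum D ψ : ℂ) = ∑ x ∈ D, ψ x := by
  have h1 : conj (∑ x ∈ D, ψ x) = ∑ x ∈ D, ψ x := by
    rw [map_sum]
    refine Finset.sum_bij' (fun x _ ↦ -x) (fun x _ ↦ -x) (fun x hx ↦ hneg x hx)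
      (fun x hx ↦ hneg x hx) (by simp) (by simp) fun x _ ↦ ?_
    rw [AddChar.map_neg_eq_conj]
  rw [← Complex.conj_eq_iff_re.1 h1, charSum, Complex.re_sum]

lemma charSum_zero (D : Finset G) : charSum D 0 = #D := by simp [charSum]

lemma charSum_neg [Finite G] (D : Finset G) (ψ : AddChar G ℂ) : charSum D (-ψ) = charSum D ψ := by
  refine Finset.sum_congr rfl fun x _ ↦ ?_
  rw [AddChar.neg_apply, AddChar.map_neg_eq_conj, Complex.conj_re]

variable [DecidableEq G]

lemma numSumReps_zero {D : Finset G} (hneg : ∀ x ∈ D, -x ∈ D) : numSumReps D 0 = #D := by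
  rw [numSumReps, Finset.filter_true_of_mem fun x hx ↦ by simpa using hneg x hx]

variable [Fintype G]

lemma sum_charSum {D : Finset G} (h0 : (0 : G) ∉ D) : ∑ ψ, charSum D ψ = 0 := by
  simp only [charSum]
  rw [Finset.sum_comm]
  refine Finset.sum_eq_zero fun x hx ↦ ?_
  rw [← Complex.re_sum, AddChar.sum_apply_eq_ite, if_neg (by rintro rfl; exact h0 hx)]
  simp

/-- The indicator of `D` equals its own square, and the transform turns pointwise products into
convolutions; the factor |G| comes from orthogonality of characters. -/
lemma charSum_conv {D : Finset G} (hneg : ∀ x ∈ D, -x ∈ D) (ψ : AddChar G ℂ) :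
    ∑ φ, charSum D φ * charSum D (ψ - φ) = Fintype.card G * charSum D ψ := by
  apply Complex.ofReal_injective
  push_cast
  simp only [ofReal_charSum hneg, Finset.sum_mul_sum]
  rw [Finset.sum_comm, Finset.mul_sum]
  simp_rw [Finset.sum_comm (s := univ)]
  rw [Finset.sum_comm]
  refine Finset.sum_congr rfl fun y hy ↦ ?_
  have h1 : ∀ x, ∑ φ : AddChar G ℂ, φ x * (ψ - φ) y
      = if x = y then Fintype.card G * ψ y else 0 := by
    intro x
    have h2 : ∀ φ : AddChar G ℂ, φ x * (ψ - φ) y = ψ y * φ (x - y) := fun φ ↦ by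
      rw [AddChar.sub_apply, sub_eq_add_neg, AddChar.map_add_eq_mul]; ring
    simp_rw [h2, ← Finset.mul_sum, AddChar.sum_apply_eq_ite, sub_eq_zero]
    split_ifs <;> ring
  simp_rw [h1, Finset.sum_ite_eq' D y]
  simp [hy]

lemma sum_charSum_sq {D : Finset G} (hneg : ∀ x ∈ D, -x ∈ D) :
    ∑ ψ, charSum D ψ ^ 2 = Fintype.card G * #D := by
  rw [← charSum_zero D, ← charSum_conv hneg 0]
  exact Finset.sum_congr rfl fun φ _ ↦ by rw [zero_sub, charSum_neg, sq]

/-- Parseval's identity for a real function on a finite abelian group. -/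
lemma sum_norm_sq_charTransform (g : G → ℝ) :
    ∑ ψ : AddChar G ℂ, ‖∑ x, (g x : ℂ) * ψ x‖ ^ 2 = Fintype.card G * ∑ x, g x ^ 2 := by
  apply Complex.ofReal_injective
  push_cast
  simp_rw [← Complex.mul_conj', map_sum, Finset.sum_mul_sum]
  rw [Finset.sum_comm, Finset.mul_sum]
  refine Finset.sum_congr rfl fun x _ ↦ ?_
  rw [Finset.sum_comm]
  have h1 : ∀ y, ∑ ψ : AddChar G ℂ, (g x : ℂ) * ψ x * conj ((g y : ℂ) * ψ y)
      = if y = x then Fintype.card G * (g x : ℂ) ^ 2 else 0 := by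
    intro y
    have h2 : ∀ ψ : AddChar G ℂ, (g x : ℂ) * ψ x * conj ((g y : ℂ) * ψ y)
        = g x * g y * ψ (x - y) := fun ψ ↦ by
      rw [map_mul, Complex.conj_ofReal, ← AddChar.map_neg_eq_conj, sub_eq_add_neg,
        AddChar.map_add_eq_mul]
      ring
    simp_rw [h2, ← Finset.mul_sum, AddChar.sum_apply_eq_ite, sub_eq_zero]
    by_cases h : y = x
    · subst h; simp; ring
    · simp [h, Ne.symm h]
  simp_rw [h1]
  simp

lemma sum_numSumReps_mul (D : Finset G) (g : G → ℂ) :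
    ∑ z, (numSumReps D z : ℂ) * g z = ∑ x ∈ D, ∑ y ∈ D, g (x + y) := by
  have h1 : ∀ z, (numSumReps D z : ℂ) * g z = ∑ x ∈ D, if z - x ∈ D then g z else 0 := fun z ↦ by
    rw [numSumReps, ← nsmul_eq_mul, ← Finset.sum_const, Finset.sum_filter]
  simp_rw [h1]
  rw [Finset.sum_comm]
  refine Finset.sum_congr rfl fun x _ ↦ ?_
  rw [← Finset.sum_filter]
  exact Finset.sum_bij' (fun z _ ↦ z - x) (fun y _ ↦ x + y) (by simp) (by simp) (by simp) (by simp)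
    (by simp)

lemma sum_numSumReps (D : Finset G) : ∑ z, (numSumReps D z : ℝ) = (#D : ℝ) ^ 2 := by
  apply Complex.ofReal_injective
  have := sum_numSumReps_mul D 1
  simp only [Pi.one_apply, mul_one, sum_const, nsmul_eq_mul] at this
  push_cast
  rw [this, sq]

/-- If the number of representations as a sum of two elements of `D` is `ℓ` on `D` and close to
`a` elsewhere, then the character sums of `D` almost satisfy a quadratic equation. -/
lemma sum_quadratic_charSum_le {D : Finset G} (h0 : (0 : G) ∉ D) (hneg : ∀ x ∈ D, -x ∈ D)
    {ℓ η a : ℝ} (hD : ∀ x ∈ D, (numSumReps D x : ℝ) = ℓ)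
    (hext : ∀ x, x ≠ 0 → x ∉ D → |(numSumReps D x : ℝ) - a| ≤ η) :
    ∑ ψ ∈ univ.erase (0 : AddChar G ℂ),
      (charSum D ψ ^ 2 + (a - ℓ) * charSum D ψ - (#D - a)) ^ 2 ≤
      (Fintype.card G : ℝ) ^ 2 * η ^ 2 := by
  -- The defect of the representation function from its model: zero at 0 and on `D`, at most `η` in
  -- size elsewhere. At a nontrivial character the constant `a` disappears, so the transform of `E`
  -- is the quadratic expression, and Parseval applies.
  set E : G → ℝ := fun z ↦ numSumReps D z + (a - ℓ) * (if z ∈ D then 1 else 0)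
    - (#D - a) * (if z = 0 then 1 else 0) - a with hE
  have hEη : ∀ z, E z ^ 2 ≤ η ^ 2 := by
    intro z
    by_cases hz : z = 0
    · subst hz
      have : E 0 = 0 := by simp [hE, h0, numSumReps_zero hneg]
      rw [this]; simpa using sq_nonneg η
    by_cases hzD : z ∈ D
    · have : E z = 0 := by simp [hE, hz, hzD, hD z hzD]
      rw [this]; simpa using sq_nonneg η
    · have : E z = numSumReps D z - a := by simp [hE, hz, hzD]
      rw [this]
      exact sq_le_sq' (abs_le.1 (hext z hz hzD)).1 (abs_le.1 (hext z hz hzD)).2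
  have htr : ∀ ψ : AddChar G ℂ, ψ ≠ 0 →
      (charSum D ψ ^ 2 + (a - ℓ) * charSum D ψ - (#D - a)) ^ 2 = ‖∑ x, (E x : ℂ) * ψ x‖ ^ 2 := by
    intro ψ hψ
    have h1 : ∑ x, (E x : ℂ) * ψ x
        = ((charSum D ψ ^ 2 + (a - ℓ) * charSum D ψ - (#D - a) : ℝ) : ℂ) := by
      have h2 : ∑ x, (numSumReps D x : ℂ) * ψ x = (charSum D ψ : ℂ) ^ 2 := by
        rw [sum_numSumReps_mul, ofReal_charSum hneg, sq, Finset.sum_mul_sum]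
        simp_rw [AddChar.map_add_eq_mul]
      have h3 : ∑ x, ψ x = 0 := by rw [AddChar.sum_eq_ite, if_neg hψ]
      calc ∑ x, (E x : ℂ) * ψ x = ∑ x, ((numSumReps D x : ℂ) * ψ x
            + (a - ℓ) * (if x ∈ D then ψ x else 0)
            - (#D - a) * (if x = 0 then ψ x else 0) - a * ψ x) := by
            refine Finset.sum_congr rfl fun x _ ↦ ?_
            simp only [hE]
            push_cast
            split_ifs <;> push_cast <;> ring
        _ = _ := by
            rw [Finset.sum_sub_distrib, Finset.sum_sub_distrib, Finset.sum_add_distrib, h2,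
              ← Finset.mul_sum, ← Finset.mul_sum, ← Finset.mul_sum, h3, Finset.sum_ite_eq',
              Finset.sum_ite_mem, Finset.univ_inter, ← ofReal_charSum hneg]
            simp
    rw [h1, Complex.norm_real, Real.norm_eq_abs, sq_abs]
  calc _ = ∑ ψ ∈ univ.erase (0 : AddChar G ℂ), ‖∑ x, (E x : ℂ) * ψ x‖ ^ 2 :=
        Finset.sum_congr rfl fun ψ hψ ↦ htr ψ (Finset.ne_of_mem_erase hψ)
    _ ≤ ∑ ψ : AddChar G ℂ, ‖∑ x, (E x : ℂ) * ψ x‖ ^ 2 :=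
        Finset.sum_le_univ_sum_of_nonneg fun _ ↦ by positivity
    _ = Fintype.card G * ∑ x, E x ^ 2 := sum_norm_sq_charTransform E
    _ ≤ Fintype.card G * ∑ _x : G, η ^ 2 := by gcongr ?_ * ∑ x, ?_; exact hEη _
    _ = _ := by simp; ring

/-- A symmetric set in a finite abelian group whose number of sum representations is constant on
the set and almost constant outside of it has size `O(|G| ^ (5 / 6))`. -/
theorem card_pow_six_lt_of_almost_constant_reps {D : Finset G} (h0 : (0 : G) ∉ D)
    (hneg : ∀ x ∈ D, -x ∈ D) {ℓ η a : ℝ} (hℓ0 : 0 ≤ ℓ)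
    (hD : ∀ x ∈ D, (numSumReps D x : ℝ) = ℓ)
    (hext : ∀ x, x ≠ 0 → x ∉ D → |(numSumReps D x : ℝ) - a| ≤ η)
    (hhalf : ∀ x, x ≠ 0 → x ∉ D → 2 * (numSumReps D x : ℝ) ≤ #D)
    (hη : 1000000 * η ^ 2 * Fintype.card G ≤ (#D : ℝ) ^ 2)
    (hsmall : 4 * Fintype.card G * (η + ℓ) ≤ (#D : ℝ) ^ 2) (hℓ : 2 * (ℓ + 1) ≤ #D) :
    (#D : ℝ) ^ 6 < 12800 * (Fintype.card G : ℝ) ^ 5 := by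
  by_contra! hcon
  obtain ⟨Q, hQ⟩ : ∃ Q : ℝ, Q = Fintype.card G := ⟨_, rfl⟩
  obtain ⟨k, hk⟩ : ∃ k : ℝ, k = #D := ⟨_, rfl⟩
  have hkQ : k ≤ Q := by rw [hk, hQ]; exact_mod_cast Finset.card_le_univ D
  have hQ1 : 1 ≤ Q := by rw [hQ]; exact_mod_cast Fintype.card_pos
  -- All k² pairs are sorted by their sum: 0, an element of `D`, or neither.
  have hcount : k ^ 2 = k + k * ℓ + ∑ x ∈ (insert 0 D)ᶜ, (numSumReps D x : ℝ) := by
    rw [hk, ← sum_numSumReps D, ← Finset.sum_add_sum_compl (insert 0 D), Finset.sum_insert h0,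
      numSumReps_zero hneg, Finset.sum_congr rfl hD]
    simp
  rw [← hk] at hη hsmall hℓ hcon hhalf
  rw [← hQ] at hη hsmall hcon
  have hk0 : 0 < k := by linarith
  -- Otherwise k² = k(1 + ℓ) ≤ k²/2. An element here is needed to transfer the pointwise bounds to
  -- `a`.
  have hne : ((insert 0 D)ᶜ).Nonempty := by
    rw [Finset.nonempty_iff_ne_empty]
    intro h
    rw [h, Finset.sum_empty] at hcount
    nlinarith
  have hmem : ∀ x ∈ (insert 0 D)ᶜ, x ≠ 0 ∧ x ∉ D := fun x hx ↦ by simpa using hx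
  obtain ⟨x₀, hx₀⟩ := hne
  have hx1 := abs_le.1 (hext x₀ (hmem x₀ hx₀).1 (hmem x₀ hx₀).2)
  have hx2 := hhalf x₀ (hmem x₀ hx₀).1 (hmem x₀ hx₀).2
  have hη0 : 0 ≤ η := (abs_nonneg _).trans (hext x₀ (hmem x₀ hx₀).1 (hmem x₀ hx₀).2)
  have hr0 : (0 : ℝ) ≤ numSumReps D x₀ := Nat.cast_nonneg _
  have ha : a ≤ k / 2 + η := by linarith
  have haη : 0 ≤ a + η := by linarith
  have hη1 : η ≤ k / 1000 := by
    refine (abs_le_of_sq_le_sq' (a := η) ?_ (by positivity)).2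
    nlinarith [sq_nonneg η]
  have hup : ∑ x ∈ (insert 0 D)ᶜ, (numSumReps D x : ℝ) ≤ Q * (a + η) := by
    calc _ ≤ ∑ x ∈ (insert 0 D)ᶜ, (a + η) := Finset.sum_le_sum fun x hx ↦ by
          linarith [(abs_le.1 (hext x (hmem x hx).1 (hmem x hx).2)).2]
      _ = #(insert 0 D)ᶜ * (a + η) := by rw [Finset.sum_const, nsmul_eq_mul]
      _ ≤ Q * (a + η) := by
          gcongr
          rw [hQ]
          exact_mod_cast Finset.card_le_univ _
  -- In `hcount`, k(1 + ℓ) takes at most k²/2, so Q(a + η) ≥ k²/2; then `hsmall` removes Q(η + ℓ) ≤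
  -- k²/4.
  have hQb : k ^ 2 / 4 ≤ Q * (a - ℓ) := by nlinarith
  obtain ⟨b, hbdef⟩ : ∃ b, b = a - ℓ := ⟨_, rfl⟩
  rw [← hbdef] at hQb
  have hb : 0 < b := pos_of_mul_pos_right (a := Q) (by nlinarith) (by linarith)
  have hbk : b ≤ k := by linarith
  have hk3 : 16 * Q ^ 2 ≤ k ^ 3 := by
    refine (abs_le_of_sq_le_sq' ?_ (by positivity)).2
    have : Q ^ 4 ≤ Q ^ 5 := pow_le_pow_right₀ hQ1 (by norm_num)
    have : 0 ≤ Q ^ 4 := by positivity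
    linarith
  have hQb2 : (k ^ 2 / 4) ^ 2 ≤ (Q * b) ^ 2 := by gcongr
  have hkb : k ≤ b ^ 2 := by
    refine le_of_mul_le_mul_left (a := Q ^ 2) ?_ (by positivity)
    calc Q ^ 2 * k ≤ k ^ 3 / 16 * k := by gcongr; linarith
      _ = (k ^ 2 / 4) ^ 2 := by ring
      _ ≤ (Q * b) ^ 2 := hQb2
      _ = Q ^ 2 * b ^ 2 := by ring
  -- This fixes the exponent 5/6: with b ≥ k²/(4Q) it suffices that k⁶ ≥ 50 · 4⁴ · Q⁵, and 50 · 256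
  -- = 12800.
  have hbig : 50 * Q * k ^ 2 ≤ b ^ 4 := by
    refine le_of_mul_le_mul_left (a := Q ^ 4) ?_ (by positivity)
    calc Q ^ 4 * (50 * Q * k ^ 2) = 12800 * Q ^ 5 * k ^ 2 / 256 := by ring
      _ ≤ k ^ 6 * k ^ 2 / 256 := by gcongr
      _ = ((k ^ 2 / 4) ^ 2) ^ 2 := by ring
      _ ≤ ((Q * b) ^ 2) ^ 2 := by gcongr
      _ = Q ^ 4 * b ^ 4 := by ring
  refine no_sparse_almost_two_valued (Γ := AddChar G ℂ) (charSum D) Q k a b η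
    (by rw [hQ, AddChar.card_eq]) hk0 hb hkb hbk hkQ ha hη hbig (by linarith)
    (by rw [hQ, hk]; exact sum_charSum_sq hneg) ?_
    (by rw [hQ]; exact charSum_conv hneg) (sum_charSum h0)
  rw [hbdef, hQ, hk]
  exact sum_quadratic_charSum_le h0 hneg hD hext

end CharacterSums

/-! ### The cone over a cap, its sum representations and secants. -/

section CapGeometry

open Projectivization Finset

variable {n : ℕ} {F : Type*} [Field F]

/-- The set of nonzero vectors representing a point of `C`. -/
def vectorCone (C : Set (PG n F)) : Set (Fin (n + 1) → F) := {x | ∃ h : x ≠ 0, mk F x h ∈ C}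

lemma zero_notMem_vectorCone (C : Set (PG n F)) : (0 : Fin (n + 1) → F) ∉ vectorCone C :=
  fun h ↦ h.1 rfl

lemma mk_smul_eq {x : Fin (n + 1) → F} (hx : x ≠ 0) {c : F} (hcx : c • x ≠ 0) :
    mk F (c • x) hcx = mk F x hx := (mk_eq_mk_iff' F _ _ _ _).2 ⟨c, rfl⟩

lemma smul_mem_vectorCone {C : Set (PG n F)} {x : Fin (n + 1) → F} (hx : x ∈ vectorCone C) {c : F}
    (hc : c ≠ 0) : c • x ∈ vectorCone C :=
  ⟨smul_ne_zero hc hx.1, by rw [mk_smul_eq hx.1]; exact hx.2⟩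

lemma neg_mem_vectorCone {C : Set (PG n F)} {x : Fin (n + 1) → F} (hx : x ∈ vectorCone C) :
    -x ∈ vectorCone C := by simpa using smul_mem_vectorCone hx (c := -1) (by simp)

lemma finrank_span_pair_le (x y : Fin (n + 1) → F) :
    Module.finrank F (Submodule.span F {x, y}) ≤ 2 := by
  classical
  have h := finrank_span_finset_le_card (R := F) ({x, y} : Finset (Fin (n + 1) → F))
  rw [coe_pair] at h
  exact h.trans card_le_two

lemma finrank_span_pair_eq {x y : Fin (n + 1) → F} {hx : x ≠ 0} {hy : y ≠ 0}
    (h : mk F x hx ≠ mk F y hy) : Module.finrank F (Submodule.span F {x, y}) = 2 := by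
  have h1 : LinearIndependent F ![x, y] := by
    rw [LinearIndependent.pair_iff' hx]
    intro c hc
    exact h ((mk_eq_mk_iff' F _ _ _ _).2 ⟨c, hc⟩).symm
  have h2 := finrank_span_eq_card h1
  rwa [Matrix.range_cons_cons_empty, Fintype.card_fin] at h2

/-- Three vectors over points of a cap which are linearly dependent: two are proportional. -/
lemma IsCap.exists_proportional {C : Set (PG n F)} (hC : IsCap C) {x y z : Fin (n + 1) → F}
    (hx : x ∈ vectorCone C) (hy : y ∈ vectorCone C) (hz : z ∈ vectorCone C)
    (hxyz : z ∈ Submodule.span F {x, y}) :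
    (∃ c : F, c • y = x) ∨ (∃ c : F, c • z = x) ∨ ∃ c : F, c • z = y := by
  by_contra! hcon
  refine hC _ hx.2 _ hy.2 _ hz.2 ?_ ?_ ?_
    ⟨(Submodule.span F {x, y}).projectivization, inferInstance, ?_, ?_⟩
  · rw [Ne, mk_eq_mk_iff']; push Not; exact hcon.1
  · rw [Ne, mk_eq_mk_iff']; push Not; exact hcon.2.1
  · rw [Ne, mk_eq_mk_iff']; push Not; exact hcon.2.2
  · rw [OrderIso.apply_symm_apply]; exact finrank_span_pair_le x y
  · rintro p (rfl | rfl | rfl)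
    · exact Submodule.subset_span (by simp)
    · exact Submodule.subset_span (by simp)
    · exact hxyz

/-- For a vector `x` outside the cone, summands of `x` in the cone are determined by their
projective point. -/
lemma IsCap.eq_of_proportional_summands {C : Set (PG n F)} (hC : IsCap C) {x d : Fin (n + 1) → F}
    (hx : x ≠ 0) (hxC : x ∉ vectorCone C) (hd : d ∈ vectorCone C) (hxd : x - d ∈ vectorCone C)
    {c : F} (hxc : x - c • d ∈ vectorCone C) : c = 1 := by
  -- `x` is not proportional to `d`, as the cone is closed under nonzero scalars.
  have hspan : ∀ α β : F, α • x = β • d → α = 0 := by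
    intro α β h
    by_contra hα
    have hx' : (α⁻¹ * β) • d = x := by rw [mul_smul, ← h, inv_smul_smul₀ hα]
    exact hxC (hx' ▸ smul_mem_vectorCone hd (left_ne_zero_of_smul (hx' ▸ hx)))
  have hmem : x - c • d ∈ Submodule.span F {d, x - d} :=
    Submodule.mem_span_pair.2 ⟨1 - c, 1, by module⟩
  rcases hC.exists_proportional hd hxd hxc hmem with ⟨e, he⟩ | ⟨e, he⟩ | ⟨e, he⟩
  · have h0 := hspan e (1 + e) (by rw [add_smul, one_smul, ← sub_eq_iff_eq_add, ← smul_sub, he])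
    exact absurd (by rw [← he, h0, zero_smul]) hd.1
  · have h0 := hspan e (1 + e * c)
      (by rw [add_smul, one_smul, mul_smul, ← sub_eq_iff_eq_add, ← smul_sub, he])
    exact absurd (by rw [← he, h0, zero_smul]) hd.1
  · have h1 : (e - 1) • x = (e * c - 1) • d := by
      rw [sub_smul, sub_smul, mul_smul, one_smul, one_smul, sub_eq_sub_iff_sub_eq_sub,
        ← smul_sub, he]
    have he1 : e = 1 := sub_eq_zero.1 (hspan _ _ h1)
    subst he1
    rw [sub_self, zero_smul, one_mul, eq_comm, smul_eq_zero, sub_eq_zero] at h1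
    exact h1.resolve_right hd.1

lemma IsCap.eq_of_mk_eq_of_summands {C : Set (PG n F)} (hC : IsCap C) {x d d' : Fin (n + 1) → F}
    (hx : x ≠ 0) (hxC : x ∉ vectorCone C) (hd : d ∈ vectorCone C) (hxd : x - d ∈ vectorCone C)
    (hd' : d' ∈ vectorCone C) (hxd' : x - d' ∈ vectorCone C)
    (h : mk F d' hd'.1 = mk F d hd.1) : d' = d := by
  obtain ⟨c, rfl⟩ := (mk_eq_mk_iff' F _ _ _ _).1 h
  rw [hC.eq_of_proportional_summands hx hxC hd hxd hxd', one_smul]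

lemma mk_ne_mk_sub {C : Set (PG n F)} {x d : Fin (n + 1) → F}
    (hx : x ≠ 0) (hxC : x ∉ vectorCone C) (hd : d ∈ vectorCone C) (hxd : x - d ∈ vectorCone C) :
    mk F d hd.1 ≠ mk F (x - d) hxd.1 := by
  rw [Ne, mk_eq_mk_iff']
  rintro ⟨c, hc⟩
  have hx' : (1 + c) • (x - d) = x := by rw [add_smul, one_smul, hc]; abel
  exact hxC (hx' ▸ smul_mem_vectorCone hxd (left_ne_zero_of_smul (hx'.symm ▸ hx)))

/-- Two summands in the cone of an exterior vector span a secant. -/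
lemma IsCap.isSecant_span {C : Set (PG n F)} (hC : IsCap C) {x d : Fin (n + 1) → F}
    (hx : x ≠ 0) (hxC : x ∉ vectorCone C) (hd : d ∈ vectorCone C) (hxd : x - d ∈ vectorCone C) :
    IsSecant C (Submodule.span F {d, x - d}).projectivization := by
  have hmk := mk_ne_mk_sub hx hxC hd hxd
  refine ⟨?_, ?_⟩
  · rw [IsLine, OrderIso.apply_symm_apply]
    exact finrank_span_pair_eq hmk
  · rw [← Set.ncard_pair hmk]
    congr 1
    ext p
    constructor
    · rintro ⟨hpC, hpL⟩
      induction p using Projectivization.ind with | h v hv =>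
      rcases hC.exists_proportional hd hxd ⟨hv, hpC⟩ hpL with ⟨c, hc⟩ | ⟨c, hc⟩ | ⟨c, hc⟩
      · exact absurd ((mk_eq_mk_iff' F _ _ _ _).2 ⟨c, hc⟩) hmk
      · exact Or.inl ((mk_eq_mk_iff' F _ _ _ _).2 ⟨c, hc⟩).symm
      · exact Or.inr ((mk_eq_mk_iff' F _ _ _ _).2 ⟨c, hc⟩).symm
    · rintro (rfl | rfl)
      · exact ⟨hd.2, Submodule.subset_span (by simp)⟩
      · exact ⟨hxd.2, Submodule.subset_span (by simp)⟩

/-- The two summands of an exterior vector on a given secant through it. -/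
lemma IsCap.exists_summands_on_secant {C : Set (PG n F)} {x : Fin (n + 1) → F}
    (hx : x ≠ 0) (hxC : x ∉ vectorCone C)
    {L : Projectivization.Subspace F (Fin (n + 1) → F)} (hL : IsSecant C L) (hxL : mk F x hx ∈ L) :
    ∃ d : Fin (n + 1) → F, ∃ (hd : d ∈ vectorCone C) (hxd : x - d ∈ vectorCone C),
      C ∩ (L : Set (PG n F)) = {mk F d hd.1, mk F (x - d) hxd.1} := by
  obtain ⟨y, z, hyz, hCL⟩ := Set.ncard_eq_two.1 hL.2
  induction y using Projectivization.ind with | h v hv =>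
  induction z using Projectivization.ind with | h w hw =>
  have hvL : mk F v hv ∈ C ∩ (L : Set (PG n F)) := by rw [hCL]; simp
  have hwL : mk F w hw ∈ C ∩ (L : Set (PG n F)) := by rw [hCL]; simp
  have hspan : Submodule.span F {v, w} = Subspace.submodule L := by
    refine Submodule.eq_of_le_of_finrank_eq ?_ ?_
    · rw [Submodule.span_le]
      rintro u (rfl | rfl)
      · exact (Subspace.mem_submodule_iff L hv).2 hvL.2
      · exact (Subspace.mem_submodule_iff L hw).2 hwL.2
    · rw [finrank_span_pair_eq hyz, hL.1]
  have hxspan : x ∈ Submodule.span F {v, w} := by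
    rw [hspan]; exact (Subspace.mem_submodule_iff L hx).2 hxL
  obtain ⟨α, β, hαβ⟩ := Submodule.mem_span_pair.1 hxspan
  have hα : α ≠ 0 := by
    rintro rfl
    rw [zero_smul, zero_add] at hαβ
    exact hxC (hαβ ▸ smul_mem_vectorCone ⟨hw, hwL.1⟩ (left_ne_zero_of_smul (hαβ.symm ▸ hx)))
  have hβ : β ≠ 0 := by
    rintro rfl
    rw [zero_smul, add_zero] at hαβ
    exact hxC (hαβ ▸ smul_mem_vectorCone ⟨hv, hvL.1⟩ (left_ne_zero_of_smul (hαβ.symm ▸ hx)))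
  have hsub : x - α • v = β • w := by rw [← hαβ]; abel
  refine ⟨α • v, smul_mem_vectorCone ⟨hv, hvL.1⟩ hα, ?_, ?_⟩
  · rw [hsub]; exact smul_mem_vectorCone ⟨hw, hwL.1⟩ hβ
  · simp only [hsub]
    rw [hCL, mk_smul_eq hv, mk_smul_eq hw]

/-! ### Counting over a finite field. -/

section Finite

variable [Fintype F]

open Classical in
/-- The finite set of nonzero vectors representing a point of `C`. -/
noncomputable def coneFinset (C : Set (PG n F)) : Finset (Fin (n + 1) → F) :=
  {x | x ∈ vectorCone C}

lemma mem_coneFinset {C : Set (PG n F)} {x : Fin (n + 1) → F} :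
    x ∈ coneFinset C ↔ x ∈ vectorCone C := by simp [coneFinset]

variable [DecidableEq F]

lemma card_coneFinset (C : Set (PG n F)) : #(coneFinset C) = C.ncard * (Fintype.card F - 1) := by
  have hfin : C.Finite := Set.toFinite C
  rw [Set.ncard_eq_toFinset_card C hfin, ← Fintype.card_units, ← card_univ, ← card_product]
  symm
  refine card_bij (fun pu _ ↦ pu.2 • pu.1.rep) ?_ ?_ ?_
  · rintro ⟨p, u⟩ hp
    simp only [mem_product, Set.Finite.mem_toFinset, mem_univ, and_true] at hp
    rw [mem_coneFinset]
    exact smul_mem_vectorCone ⟨p.rep_nonzero, by rwa [mk_rep]⟩ u.ne_zero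
  · rintro ⟨p, u⟩ - ⟨p', u'⟩ - h
    have hpp : p = p' := by
      rw [← p.mk_rep, ← p'.mk_rep, mk_eq_mk_iff]
      exact ⟨u⁻¹ * u', by simp only at h; rw [mul_smul, ← h, inv_smul_smul]⟩
    subst hpp
    have := smul_left_injective F p.rep_nonzero (a₁ := (u : F)) (a₂ := u') h
    rw [Units.ext this]
  · intro x hx
    obtain ⟨hx0, hxC⟩ := mem_coneFinset.1 hx
    obtain ⟨u, hu⟩ := exists_smul_eq_mk_rep F x hx0
    exact ⟨(mk F x hx0, u⁻¹), by simpa using hxC, by simp [← hu]⟩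

/-- If x = d + (x - d) with all three in the cone, the cap property forces them onto one point. So d
= c x, and c = 0, 1 are excluded because summands must be nonzero. -/
lemma numSumReps_of_mem {C : Set (PG n F)} (hC : IsCap C) {x : Fin (n + 1) → F}
    (hx : x ∈ vectorCone C) : numSumReps (coneFinset C) x = Fintype.card F - 2 := by
  have hx0 : x ≠ 0 := hx.1
  have h1 : ({d ∈ coneFinset C | x - d ∈ coneFinset C} : Finset (Fin (n + 1) → F))
      = ((univ.erase (0 : F)).erase 1).image (· • x) := by
    ext d
    simp only [mem_filter, mem_coneFinset, mem_image, mem_erase, mem_univ, and_true]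
    constructor
    · rintro ⟨hd, hxd⟩
      obtain ⟨c, hc⟩ : ∃ c : F, c • x = d := by
        have hmem : x ∈ Submodule.span F {d, x - d} :=
          Submodule.mem_span_pair.2 ⟨1, 1, by simp⟩
        rcases hC.exists_proportional hd hxd hx hmem with ⟨c, hc⟩ | ⟨c, hc⟩ | ⟨c, hc⟩
        · have hc' : (1 + c) • d = c • x := by
            rw [add_smul, one_smul, smul_sub] at *
            exact (sub_eq_iff_eq_add.1 hc).symm
          by_cases h1c : 1 + c = 0
          · rw [h1c, zero_smul, eq_comm, smul_eq_zero] at hc'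
            rcases hc' with rfl | h
            · simp at h1c
            · exact absurd h hx0
          · exact ⟨(1 + c)⁻¹ * c, by rw [mul_smul, ← hc', inv_smul_smul₀ h1c]⟩
        · exact ⟨c, hc⟩
        · exact ⟨1 - c, by rw [sub_smul, one_smul, hc]; abel⟩
      refine ⟨c, ⟨?_, ?_⟩, hc⟩
      · rintro rfl
        exact hxd.1 (by simp [← hc])
      · rintro rfl
        exact hd.1 (by simp [← hc])
    · rintro ⟨c, ⟨hc1, hc0⟩, rfl⟩
      refine ⟨smul_mem_vectorCone hx hc0, ?_⟩
      have : x - c • x = (1 - c) • x := by rw [sub_smul, one_smul]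
      rw [this]
      exact smul_mem_vectorCone hx (sub_ne_zero.2 (Ne.symm hc1))
  rw [numSumReps, h1, card_image_of_injective _ (smul_left_injective F hx0),
    card_erase_of_mem (by simp), card_erase_of_mem (by simp), card_univ]
  omega

/-- Each cap point supplies at most one summand, since two summands over the same point coincide. -/
lemma numSumReps_le {C : Set (PG n F)} (hC : IsCap C) {x : Fin (n + 1) → F}
    (hx : x ≠ 0) (hxC : x ∉ vectorCone C) : numSumReps (coneFinset C) x ≤ C.ncard := by
  have hfin : C.Finite := Set.toFinite C
  rw [Set.ncard_eq_toFinset_card C hfin, numSumReps]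
  have hmem : ∀ d ∈ ({d ∈ coneFinset C | x - d ∈ coneFinset C} : Finset (Fin (n + 1) → F)),
      d ∈ vectorCone C ∧ x - d ∈ vectorCone C := fun d hd ↦ by
    simpa [mem_coneFinset] using hd
  refine card_le_card_of_forall_subsingleton (fun d p ↦ ∃ h : d ≠ 0, mk F d h = p) ?_ ?_
  · intro d hd
    exact ⟨mk F d (hmem d hd).1.1, by simpa using (hmem d hd).1.2, (hmem d hd).1.1, rfl⟩
  · rintro p - d ⟨hd, h0, h⟩ d' ⟨hd', h0', h'⟩
    exact hC.eq_of_mk_eq_of_summands hx hxC (hmem d' hd').1 (hmem d' hd').2 (hmem d hd).1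
      (hmem d hd).2 (h.trans h'.symm)

/-- Outside the cone, the number of sum representations is twice the number of secants. -/
lemma numSumReps_eq_two_mul_numSecants {C : Set (PG n F)} (hC : IsCap C) {x : Fin (n + 1) → F}
    (hx : x ≠ 0) (hxC : x ∉ vectorCone C) :
    numSumReps (coneFinset C) x = 2 * numSecants C (mk F x hx) := by
  classical
  have : Finite (Projectivization.Subspace F (Fin (n + 1) → F)) :=
    Finite.of_equiv _ (Subspace.submodule (K := F) (V := Fin (n + 1) → F)).toEquiv.symm
  have hfin : {L : Projectivization.Subspace F (Fin (n + 1) → F) |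
    IsSecant C L ∧ mk F x hx ∈ L}.Finite := Set.toFinite _
  rw [numSecants, Set.ncard_eq_toFinset_card _ hfin, numSumReps]
  have hmem : ∀ d, d ∈ ({d ∈ coneFinset C | x - d ∈ coneFinset C} : Finset (Fin (n + 1) → F)) ↔
      d ∈ vectorCone C ∧ x - d ∈ vectorCone C := fun d ↦ by simp [mem_coneFinset]
  -- Each summand `d` is sent to the secant spanned by `d` and `x - d`; every fibre consists of the
  -- two summands of one decomposition.
  rw [card_eq_sum_card_fiberwise (t := hfin.toFinset)
    (f := fun d ↦ (Submodule.span F {d, x - d}).projectivization), mul_comm]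
  · refine sum_const_nat fun L hL ↦ ?_
    obtain ⟨hL1, hL2⟩ := (Set.Finite.mem_toFinset _).1 hL
    obtain ⟨e, he, hxe, hCL⟩ := IsCap.exists_summands_on_secant hx hxC hL1 hL2
    have hxxe : x - (x - e) = e := sub_sub_cancel x e
    have hne : e ≠ x - e := fun h ↦ mk_ne_mk_sub hx hxC he hxe (by simp only [← h])
    have hspan : (Submodule.span F {e, x - e}).projectivization = L := by
      refine (OrderIso.symm_apply_eq _).2 (Submodule.eq_of_le_of_finrank_eq ?_ ?_)
      · rw [Submodule.span_le]
        have h1 : mk F e he.1 ∈ C ∩ (L : Set (PG n F)) := by rw [hCL]; simp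
        have h2 : mk F (x - e) hxe.1 ∈ C ∩ (L : Set (PG n F)) := by rw [hCL]; simp
        rintro u (rfl | rfl)
        · exact (Subspace.mem_submodule_iff L he.1).2 h1.2
        · exact (Subspace.mem_submodule_iff L hxe.1).2 h2.2
      · rw [finrank_span_pair_eq (mk_ne_mk_sub hx hxC he hxe), hL1.1]
    rw [← card_pair hne]
    congr 1
    ext d
    rw [mem_filter, hmem, mem_insert, mem_singleton]
    constructor
    · rintro ⟨⟨hd, hxd⟩, rfl⟩
      have h1 : mk F d hd.1 ∈ ({mk F e he.1, mk F (x - e) hxe.1} : Set (PG n F)) := by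
        rw [← hCL]
        exact ⟨hd.2, Submodule.subset_span (by simp)⟩
      rcases h1 with h1 | h1
      · exact Or.inl (hC.eq_of_mk_eq_of_summands hx hxC he hxe hd hxd h1)
      · exact Or.inr (hC.eq_of_mk_eq_of_summands hx hxC hxe (by rwa [hxxe]) hd hxd h1)
    · rintro (rfl | rfl)
      · exact ⟨⟨he, hxe⟩, hspan⟩
      · exact ⟨⟨hxe, by rwa [hxxe]⟩, by rw [hxxe, Set.pair_comm]; exact hspan⟩
  · intro d hd
    obtain ⟨h1, h2⟩ := (hmem d).1 hd
    simp only [Set.Finite.coe_toFinset, Set.mem_ofPred_eq]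
    exact ⟨hC.isSecant_span hx hxC h1 h2, Submodule.mem_span_pair.2 ⟨1, 1, by simp⟩⟩

end Finite

end CapGeometry

/-! ### The bound for caps. -/

/-- A cap all of whose exterior points lie on almost the same number of secants is small. -/
theorem IsCap.ncard_le_of_secantDeviationLE {n : ℕ} (hn : 4 ≤ n) {F : Type*} [Field F] [Finite F]
    (hq : 3 ≤ Nat.card F) {C : Set (PG n F)} (hC : IsCap C) {c : ℝ} (hdev : SecantDeviationLE C c) :
    (C.ncard : ℝ) ≤ (3000 * |c| + 150) * (Nat.card F : ℝ) ^ ((5 / 6 : ℝ) * (n : ℝ) - 1 / 6) := by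
  classical
  have : Fintype F := Fintype.ofFinite F
  by_contra! hcon
  obtain ⟨q, hqdef⟩ : ∃ q : ℝ, q = Nat.card F := ⟨_, rfl⟩
  have hq3 : 3 ≤ q := by rw [hqdef]; exact_mod_cast hq
  have hq1 : 1 ≤ q := by linarith
  obtain ⟨Q, hQ⟩ : ∃ Q : ℝ, Q = q ^ (n + 1) := ⟨_, rfl⟩
  have hQcard : (Fintype.card (Fin (n + 1) → F) : ℝ) = Q := by
    rw [hQ, hqdef, Nat.card_eq_fintype_card]; simp
  obtain ⟨y, hy⟩ : ∃ y : ℝ, y = q ^ ((5 / 6 : ℝ) * (n : ℝ) - 1 / 6) := ⟨_, rfl⟩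
  rw [← hqdef, ← hy] at hcon
  have hy0 : 0 < y := by rw [hy]; positivity
  -- `Y` is Q^(5/6), the threshold for the cone; the factor q reflects k = t(q - 1).
  obtain ⟨Y, hY⟩ : ∃ Y : ℝ, Y = y * q := ⟨_, rfl⟩
  have hY0 : 0 < Y := by rw [hY]; positivity
  have hY6 : Y ^ 6 = Q ^ 5 := by
    have h1 : Y = q ^ ((5 / 6 : ℝ) * (n + 1 : ℝ)) := by
      rw [hY, hy, ← Real.rpow_add_one (by positivity)]; congr 1; ring
    rw [h1, hQ, ← Real.rpow_natCast, ← Real.rpow_mul (by positivity), ← pow_mul,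
      ← Real.rpow_natCast]
    congr 1; push_cast; ring
  have hq2Q : q ^ 5 ≤ Q := by rw [hQ]; exact pow_le_pow_right₀ hq1 (by omega)
  have hqQ : q ≤ Q := by rw [hQ]; exact le_self_pow₀ hq1 (by omega)
  have hQ1 : 1 ≤ Q := hq1.trans hqQ
  have hYq : q ≤ Y := by
    refine le_of_pow_le_pow_left₀ (n := 6) (by norm_num) hY0.le ?_
    rw [hY6]
    calc q ^ 6 ≤ q ^ 25 := pow_le_pow_right₀ hq1 (by norm_num)
      _ = (q ^ 5) ^ 5 := by ring
      _ ≤ Q ^ 5 := by gcongr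
  have hYQq : Q * q ≤ Y ^ 2 := by
    refine le_of_pow_le_pow_left₀ (n := 3) (by norm_num) (by positivity) ?_
    calc (Q * q) ^ 3 = Q ^ 3 * q ^ 3 := by ring
      _ ≤ Q ^ 3 * (q ^ 5) ^ 2 := by
        gcongr
        rw [← pow_mul]
        exact pow_le_pow_right₀ hq1 (by norm_num)
      _ ≤ Q ^ 3 * Q ^ 2 := by gcongr
      _ = Y ^ 6 := by rw [hY6]; ring
      _ = (Y ^ 2) ^ 3 := by ring
  have hYQ : Q ≤ Y ^ 2 := by nlinarith
  obtain ⟨k, hk⟩ : ∃ k : ℝ, k = (coneFinset C).card := ⟨_, rfl⟩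
  obtain ⟨t, ht⟩ : ∃ t : ℝ, t = C.ncard := ⟨_, rfl⟩
  have hkt : k = t * (q - 1) := by
    rw [hk, card_coneFinset, ht, hqdef, Nat.card_eq_fintype_card, Nat.cast_mul,
      Nat.cast_sub Fintype.card_pos, Nat.cast_one]
  rw [← ht] at hcon
  have hc0 : 0 ≤ |c| := abs_nonneg c
  -- Since q ≥ 3, q - 1 ≥ 2q/3. The term 2000|c| matches 10⁶η² with η = 2|c|; the 100 covers the
  -- remaining size conditions.
  have hkY : (2000 * |c| + 100) * Y ≤ k := by
    rw [hkt, hY]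
    calc (2000 * |c| + 100) * (y * q) = (3000 * |c| + 150) * y * (2 / 3 * q) := by ring
      _ ≤ t * (q - 1) := by
        gcongr <;> linarith
  have ht0 : 0 ≤ t := by rw [ht]; positivity
  have hℓ : ((Fintype.card F - 2 : ℕ) : ℝ) = q - 2 := by
    rw [hqdef, Nat.card_eq_fintype_card, Nat.cast_sub (by rw [← Nat.card_eq_fintype_card]; omega)]
    norm_num
  have hk2 : (2000 * |c| + 100) ^ 2 * Y ^ 2 ≤ k ^ 2 := by
    rw [← mul_pow]; gcongr
  have hext : ∀ x : Fin (n + 1) → F, x ∉ coneFinset C → x ∉ vectorCone C :=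
    fun x hx h ↦ hx (mem_coneFinset.2 h)
  have hmain := card_pow_six_lt_of_almost_constant_reps (D := coneFinset C) (ℓ := q - 2)
    (η := 2 * |c|) (a := 2 * meanSecants C)
    (fun h ↦ zero_notMem_vectorCone C (mem_coneFinset.1 h))
    (fun x hx ↦ mem_coneFinset.2 (neg_mem_vectorCone (mem_coneFinset.1 hx)))
    (by linarith)
    (fun x hx ↦ by rw [numSumReps_of_mem hC (mem_coneFinset.1 hx), hℓ])
    (fun x hx hxC ↦ by
      rw [numSumReps_eq_two_mul_numSecants hC hx (hext x hxC)]
      have h1 := hdev (.mk F x hx) fun h ↦ hext x hxC ⟨hx, h⟩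
      push_cast
      rw [← mul_sub, abs_mul, abs_two, abs_sub_comm]
      linarith [le_abs_self c])
    -- At most t representations, and k = t(q - 1) ≥ 2t: here q ≥ 3 is essential.
    (fun x hx hxC ↦ by
      have h1 : (numSumReps (coneFinset C) x : ℝ) ≤ t := by
        rw [ht]; exact_mod_cast numSumReps_le hC hx (hext x hxC)
      rw [← hk, hkt]
      nlinarith)
  rw [hQcard, ← hk] at hmain
  refine absurd (hmain ?_ ?_ ?_) (not_lt.2 ?_)
  · calc 1000000 * (2 * |c|) ^ 2 * Q ≤ 1000000 * (2 * |c|) ^ 2 * Y ^ 2 := by gcongr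
      _ = (2000 * |c|) ^ 2 * Y ^ 2 := by ring
      _ ≤ (2000 * |c| + 100) ^ 2 * Y ^ 2 := by gcongr; linarith
      _ ≤ k ^ 2 := hk2
  · calc 4 * Q * (2 * |c| + (q - 2)) ≤ 8 * |c| * Q + 4 * (Q * q) := by linarith
      _ ≤ 8 * |c| * Y ^ 2 + 4 * Y ^ 2 := by gcongr
      _ = (8 * |c| + 4) * Y ^ 2 := by ring
      _ ≤ (2000 * |c| + 100) ^ 2 * Y ^ 2 := by gcongr; nlinarith
      _ ≤ k ^ 2 := hk2
  · nlinarith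
  · have h100 : 100 * Y ≤ k := by nlinarith
    calc 12800 * Q ^ 5 ≤ 100 ^ 6 * Q ^ 5 := by gcongr; norm_num
      _ = (100 * Y) ^ 6 := by rw [mul_pow, hY6]
      _ ≤ k ^ 6 := by gcongr

theorem mainTheorem1 :
    -- `n` fixed and `q` growing
    (∀ n : ℕ, 4 ≤ n → ∀ c : ℝ, ∃ K : ℝ,
      ∀ (F : Type*) [Field F] [Finite F], 3 ≤ Nat.card F →
        ∀ C : Set (PG n F), IsCap C → SecantDeviationLE C c →
          (C.ncard : ℝ) ≤ K * (Nat.card F : ℝ) ^ ((5 / 6 : ℝ) * (n : ℝ) - 1 / 6)) ∧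
    -- `q` fixed and `n` growing
    (∀ q : ℕ, 3 ≤ q → ∀ c : ℝ, ∃ K : ℝ,
      ∀ (F : Type*) [Field F] [Finite F], Nat.card F = q →
        ∀ n : ℕ, 4 ≤ n → ∀ C : Set (PG n F), IsCap C → SecantDeviationLE C c →
          (C.ncard : ℝ) ≤ K * (q : ℝ) ^ ((5 / 6 : ℝ) * (n : ℝ) - 1 / 6)) := by
  -- The constant depends on `c` alone, so it serves both regimes.
  refine ⟨fun n hn c ↦ ⟨3000 * |c| + 150, fun F _ _ hq C hC hdev ↦
    hC.ncard_le_of_secantDeviationLE hn hq hdev⟩, fun q hq c ↦ ⟨3000 * |c| + 150, ?_⟩⟩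
  intro F _ _ hF n hn C hC hdev
  subst hF
  exact hC.ncard_le_of_secantDeviationLE hn hq hdev
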